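/- Let $p>1$ be an odd integer and let $y$ be a nonzero real number. Put $w_3=1$ and $w_p=0$ for $p\ge 5$. Then all the series below converge absolutely, and \begin{align*} \sum_{n=1}^{\infty}\frac{(-1)^n n^{p-1}}{\cosh(ny)\sinh^2(ny)} ={}&-\frac{\pi^{p-1}}{y^p}(p-1)(-1)^{(p-3)/2}\sum_{n=1}^{\infty}\frac{(-1)^n n^{p-2}}{\sinh(\pi^2n/y)}-\frac{w_p}{2y^2}\\ &+\frac{\pi^p}{2^{p-1}y^p}(-1)^{(p-1)/2}\sum_{n=1}^{\infty}\frac{(-1)^n(2n-1)^{p-1}}{\sinh((2n-1)\pi^2/(2y))}\\ &-\frac{\pi^{p+1}}{y^{p+1}}(-1)^{(p-1)/2}\sum_{n=1}^{\infty}\frac{(-1)^n n^{p-1}\cosh(n\pi^2/y)}{\sinh^2(n\pi^2/y)},\\[1ex] \sum_{n=1}^{\infty}\frac{(-1)^n n^{p}}{\sinh(ny)\cosh^2(ny)} ={}&-\frac{\pi^{p+1}}{y^{p+1}}(-1)^{(p-1)/2}\sum_{n=1}^{\infty}\frac{(-1)^n n^{p}}{\sinh(\pi^2n/y)}\\ &+\frac{p\,\pi^p}{2^{p-1}y^{p+1}}(-1)^{(p-1)/2}\sum_{n=1}^{\infty}\frac{(-1)^n(2n-1)^{p-1}}{\sinh((2n-1)\pi^2/(2y))}\\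 &-\frac{\pi^{p+2}}{2^py^{p+2}}(-1)^{(p-1)/2}\sum_{n=1}^{\infty}\frac{(-1)^n(2n-1)^{p}\cosh((2n-1)\pi^2/(2y))}{\sinh^2((2n-1)\pi^2/(2y))},\\[1ex] \sum_{n=1}^{\infty}\frac{(-1)^n (2n-1)^{p}}{\sinh^2((2n-1)y/2)\cosh((2n-1)y/2)} ={}&-\frac{\pi^{p+1}}{y^{p+1}}(-1)^{(p-1)/2}\sum_{n=1}^{\infty}\frac{(-1)^n (2n-1)^{p}}{\cosh((2n-1)\pi^2/(2y))}\\ &-\frac{p\,2^p\pi^p}{y^{p+1}}(-1)^{(p-1)/2}\sum_{n=1}^{\infty}\frac{(-1)^n n^{p-1}}{\cosh(\pi^2n/y)}\\ &+\frac{2^p\pi^{p+2}}{y^{p+2}}(-1)^{(p-1)/2}\sum_{n=1}^{\infty}\frac{(-1)^n n^{p}\sinh(\pi^2n/y)}{\cosh^2(\pi^2n/y)}. \end{align*} -/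

import Mathlib

open Real

/-- The constant `w_p`: it is `1` for `p = 3` and `0` for the other odd `p > 1`. -/
noncomputable def wConst (p : ℕ) : ℝ := if p = 3 then 1 else 0

/-! Since `cosh² - sinh² = 1`, each left-hand summand splits into a `csch` or `sech` term and a
derivative term such as `cosh / sinh²`. The derivative terms come from differentiating simpler
series in `y`, so everything reduces to functional equations under `y ↦ π² / y` for the alternating
`csch` and `sech` series over integers and over odd integers. These equations express the symmetry
of a sign-twisted Eisenstein series over points with both coordinates odd: a quarter turn swaps the
two twists (`oddLatticeSum_swap`). Summing by rows, the Lipschitz formula turns each row into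
exponentials (`oddRowSum_one`, `oddRowSum_neg_one`), and geometric summation over the rows gives the
hyperbolic series (`oddLatticeSum_eq_of_row`). Absolute convergence needs weight at least 3. The
first formula with `p = 3` needs weight 2, where the quasi-modularity of `G2` is used instead
(`cschSum_one_transform`); its anomalous term `-1 / (2 y)` differentiates to the `wConst` term.
`deriv_transform` differentiates the functional equations, and parity in `y` covers negative `y`. -/

/-! ### Exponential decay of the hyperbolic kernels -/

/-- `f` decays at least as fast as `exp (-u)` on every half-line `[r, ∞)` with `r > 0`. -/
def ExpDecay (f : ℝ → ℝ) : Prop := ∀ r > 0, ∃ C, ∀ u ≥ r, |f u| ≤ C * exp (-u)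

lemma expDecay_sech : ExpDecay fun u => (cosh u)⁻¹ := by
  refine fun r _ => ⟨2, fun u _ => ?_⟩
  rw [abs_of_pos (inv_pos.2 (cosh_pos u)), inv_le_iff_one_le_mul₀ (cosh_pos u), cosh_eq]
  have h : exp (-u) * exp u = 1 := by rw [← exp_add]; simp
  nlinarith [sq_nonneg (exp (-u))]

lemma exp_le_mul_sinh {r u : ℝ} (hr : 0 < r) (hu : r ≤ u) :
    exp u ≤ 2 / (1 - exp (-2 * r)) * sinh u := by
  have h0 : 0 < 1 - exp (-2 * r) := by
    have := exp_lt_exp.2 (show -2 * r < 0 by linarith)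
    rw [exp_zero] at this
    linarith
  rw [div_mul_eq_mul_div, le_div_iff₀ h0, sinh_eq]
  have h1 : exp (-u) ≤ exp u * exp (-2 * r) := by
    rw [← exp_add]; exact exp_le_exp.2 (by linarith)
  linarith

lemma expDecay_csch : ExpDecay fun u => (sinh u)⁻¹ := by
  refine fun r hr => ⟨2 / (1 - exp (-2 * r)), fun u hu => ?_⟩
  have hs : 0 < sinh u := sinh_pos_iff.2 (by linarith)
  rw [abs_of_pos (inv_pos.2 hs), inv_le_iff_one_le_mul₀ hs, exp_neg]
  have := exp_le_mul_sinh hr hu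
  have he := exp_pos u
  field_simp at this ⊢
  linarith

lemma expDecay_csch_deriv : ExpDecay fun u => cosh u / sinh u ^ 2 := by
  intro r hr
  obtain ⟨C, hC⟩ := expDecay_csch r hr
  refine ⟨C * (2 / (1 - exp (-2 * r))), fun u hu => ?_⟩
  have hs : 0 < sinh u := sinh_pos_iff.2 (by linarith)
  have h1 : cosh u / sinh u ≤ 2 / (1 - exp (-2 * r)) := by
    rw [div_le_iff₀ hs]
    refine le_trans ?_ (exp_le_mul_sinh hr hu)
    rw [cosh_eq]
    have := exp_le_exp.2 (show -u ≤ u by linarith)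
    linarith
  have h2 := hC u hu
  rw [abs_of_pos (inv_pos.2 hs)] at h2
  rw [abs_of_pos (div_pos (cosh_pos u) (by positivity))]
  calc cosh u / sinh u ^ 2 = (sinh u)⁻¹ * (cosh u / sinh u) := by field_simp
    _ ≤ (C * exp (-u)) * (2 / (1 - exp (-2 * r))) :=
      mul_le_mul h2 h1 (div_pos (cosh_pos u) hs).le (le_trans (inv_pos.2 hs).le h2)
    _ = _ := by ring

lemma expDecay_sech_deriv : ExpDecay fun u => sinh u / cosh u ^ 2 := by
  intro r hr
  obtain ⟨C, hC⟩ := expDecay_sech r hr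
  refine ⟨C, fun u hu => le_trans ?_ (hC u hu)⟩
  have hs : 0 < sinh u := sinh_pos_iff.2 (by linarith)
  have hc := cosh_pos u
  rw [abs_of_pos (by positivity), abs_of_pos (by positivity), div_le_iff₀ (by positivity)]
  have := (sinh_lt_cosh u).le
  field_simp
  exact this

lemma summable_pnat_pow_mul_exp (k : ℕ) {r : ℝ} (hr : 0 < r) :
    Summable fun n : ℕ+ => ((n : ℕ) : ℝ) ^ k * exp (-(r * n)) :=
  ((summable_pow_mul_exp_neg_nat_mul k hr).comp_injective PNat.coe_injective).congr
    fun n => by simp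

/-! ### Summing and differentiating series of dilates -/

section Dilation

variable {f f' : ℝ → ℝ} {c l : ℕ+ → ℝ} {A : ℝ} {k : ℕ}

/-- The bound is uniform in `y ≥ r`, as termwise differentiation requires. The condition `n / 2 ≤ l
n` covers both frequencies in use, `n` and `(2 n - 1) / 2`. -/
lemma ExpDecay.exists_bound (hf : ExpDecay f) (hc : ∀ n, |c n| ≤ A * (n : ℝ) ^ k)
    (hl : ∀ n : ℕ+, (n : ℝ) / 2 ≤ l n) {r : ℝ} (hr : 0 < r) :
    ∃ B, ∀ y ≥ r, ∀ n, ‖c n * f (l n * y)‖ ≤ B * ((n : ℝ) ^ k * exp (-(r / 2 * n))) := by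
  obtain ⟨C, hC⟩ := hf (r / 2) (by positivity)
  refine ⟨A * C, fun y hy n => ?_⟩
  have hn : (1 : ℝ) ≤ n := by exact_mod_cast (one_le : 1 ≤ n)
  have h1 : r / 2 * n ≤ l n * y := by
    calc r / 2 * n = n / 2 * r := by ring
      _ ≤ l n * y := mul_le_mul (hl n) hy hr.le (le_trans (by positivity) (hl n))
  have h2 := hC (l n * y) (le_trans (by nlinarith) h1)
  have hC0 : 0 ≤ C := by
    by_contra h
    have := le_trans (abs_nonneg _) h2
    nlinarith [exp_pos (-(l n * y))]
  rw [norm_mul, norm_eq_abs, norm_eq_abs]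
  calc |c n| * |f (l n * y)| ≤ (A * (n : ℝ) ^ k) * (C * exp (-(r / 2 * n))) := by
        refine mul_le_mul (hc n) (h2.trans ?_) (abs_nonneg _) ((abs_nonneg _).trans (hc n))
        gcongr
    _ = _ := by ring

lemma ExpDecay.summable (hf : ExpDecay f) (hc : ∀ n, |c n| ≤ A * (n : ℝ) ^ k)
    (hl : ∀ n : ℕ+, (n : ℝ) / 2 ≤ l n) {y : ℝ} (hy : 0 < y) :
    Summable fun n => c n * f (l n * y) := by
  obtain ⟨B, hB⟩ := hf.exists_bound hc hl hy
  exact Summable.of_norm_bounded ((summable_pnat_pow_mul_exp k (half_pos hy)).mul_left B)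
    (hB y le_rfl)

lemma ExpDecay.summable_of_ne (hf : ExpDecay f) (hpar : ∀ u, |f (-u)| = |f u|)
    (hc : ∀ n, |c n| ≤ A * (n : ℝ) ^ k) (hl : ∀ n : ℕ+, (n : ℝ) / 2 ≤ l n) {y : ℝ} (hy : y ≠ 0) :
    Summable fun n => c n * f (l n * y) := by
  refine Summable.of_norm ((hf.summable hc hl (abs_pos.2 hy)).norm.congr fun n => ?_)
  rcases abs_choice y with h | h <;> simp [h, hpar]

lemma ExpDecay.hasDerivAt_tsum (hf : ExpDecay f) (hf' : ExpDecay f')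
    (hd : ∀ u > 0, HasDerivAt f (f' u) u) (hc : ∀ n, |c n| ≤ A * (n : ℝ) ^ k)
    (hl : ∀ n : ℕ+, (n : ℝ) / 2 ≤ l n) (hl' : ∀ n : ℕ+, l n ≤ n) {y : ℝ} (hy : 0 < y) :
    HasDerivAt (fun x => ∑' n, c n * f (l n * x)) (∑' n, c n * l n * f' (l n * y)) y := by
  have hc' : ∀ n, |c n * l n| ≤ A * (n : ℝ) ^ (k + 1) := by
    intro n
    have h0 : 0 ≤ l n := le_trans (by positivity) (hl n)
    rw [abs_mul, abs_of_nonneg h0, pow_succ, ← mul_assoc]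
    exact mul_le_mul (hc n) (hl' n) h0 ((abs_nonneg _).trans (hc n))
  obtain ⟨B, hB⟩ := hf'.exists_bound hc' hl (half_pos hy)
  -- The half-line beyond `y / 2` stays away from `0`, so one summable bound serves for all
  -- derivatives; the chain-rule factor `l n ≤ n` costs one power of `n`.
  refine hasDerivAt_tsum_of_isPreconnected
    ((summable_pnat_pow_mul_exp (k + 1) (half_pos (half_pos hy))).mul_left B) (t := Set.Ioi (y / 2))
    (g := fun n x => c n * f (l n * x)) (g' := fun n x => c n * l n * f' (l n * x))
    isOpen_Ioi isPreconnected_Ioi ?_ ?_ (y₀ := y) (by simp [hy]) (hf.summable hc hl hy)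
    (by simp [hy])
  · intro n x hx
    have hx' : 0 < x := lt_trans (half_pos hy) hx
    have hn : (1 : ℝ) ≤ n := by exact_mod_cast (one_le : 1 ≤ n)
    have h0 : 0 < l n := lt_of_lt_of_le (by positivity) (hl n)
    have := ((hd (l n * x) (by positivity)).comp x ((hasDerivAt_id x).const_mul (l n))).const_mul
      (c n)
    refine this.congr_deriv ?_
    ring
  · exact fun n x hx => hB x (le_of_lt hx) n

end Dilation

/-! ### The seven series: convergence, parity, derivatives -/

/-- The alternating series of `n ^ k / sinh (n y)`. -/
noncomputable def cschSum (k : ℕ) (y : ℝ) : ℝ :=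
  ∑' n : ℕ+, (-1 : ℝ) ^ (n : ℕ) * (n : ℝ) ^ k / sinh (n * y)

/-- The alternating series of `n ^ k / cosh (n y)`. -/
noncomputable def sechSum (k : ℕ) (y : ℝ) : ℝ :=
  ∑' n : ℕ+, (-1 : ℝ) ^ (n : ℕ) * (n : ℝ) ^ k / cosh (n * y)

/-- The alternating series of `(2 n - 1) ^ k / sinh ((2 n - 1) y / 2)`. -/
noncomputable def oddCschSum (k : ℕ) (y : ℝ) : ℝ :=
  ∑' n : ℕ+, (-1 : ℝ) ^ (n : ℕ) * (2 * (n : ℝ) - 1) ^ k / sinh ((2 * n - 1) * y / 2)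

/-- The alternating series of `(2 n - 1) ^ k / cosh ((2 n - 1) y / 2)`. -/
noncomputable def oddSechSum (k : ℕ) (y : ℝ) : ℝ :=
  ∑' n : ℕ+, (-1 : ℝ) ^ (n : ℕ) * (2 * (n : ℝ) - 1) ^ k / cosh ((2 * n - 1) * y / 2)

/-- The alternating series of `n ^ k cosh (n y) / sinh (n y) ^ 2`. -/
noncomputable def cothCschSum (k : ℕ) (y : ℝ) : ℝ :=
  ∑' n : ℕ+, (-1 : ℝ) ^ (n : ℕ) * (n : ℝ) ^ k * cosh (n * y) / sinh (n * y) ^ 2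

/-- The alternating series of `n ^ k sinh (n y) / cosh (n y) ^ 2`. -/
noncomputable def tanhSechSum (k : ℕ) (y : ℝ) : ℝ :=
  ∑' n : ℕ+, (-1 : ℝ) ^ (n : ℕ) * (n : ℝ) ^ k * sinh (n * y) / cosh (n * y) ^ 2

/-- The alternating series of
`(2 n - 1) ^ k cosh ((2 n - 1) y / 2) / sinh ((2 n - 1) y / 2) ^ 2`. -/
noncomputable def oddCothCschSum (k : ℕ) (y : ℝ) : ℝ :=
  ∑' n : ℕ+, (-1 : ℝ) ^ (n : ℕ) * (2 * (n : ℝ) - 1) ^ k * cosh ((2 * n - 1) * y / 2) /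
    sinh ((2 * n - 1) * y / 2) ^ 2

lemma abs_coeff_le (k : ℕ) (n : ℕ+) : |(-1 : ℝ) ^ (n : ℕ) * (n : ℝ) ^ k| ≤ 1 * (n : ℝ) ^ k := by
  simp [abs_mul]

lemma abs_oddCoeff_le (k : ℕ) (n : ℕ+) :
    |(-1 : ℝ) ^ (n : ℕ) * (2 * (n : ℝ) - 1) ^ k| ≤ 2 ^ k * (n : ℝ) ^ k := by
  have hn : (1 : ℝ) ≤ n := by exact_mod_cast (one_le : 1 ≤ n)
  rw [abs_mul, abs_pow, abs_neg, abs_one, one_pow, one_mul, ← mul_pow, abs_pow,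
    abs_of_nonneg (by linarith : (0 : ℝ) ≤ 2 * n - 1)]
  gcongr <;> linarith

lemma half_le_pnat (n : ℕ+) : (n : ℝ) / 2 ≤ n := by
  have hn : (1 : ℝ) ≤ n := by exact_mod_cast (one_le : 1 ≤ n)
  linarith

lemma half_le_oddHalf (n : ℕ+) : (n : ℝ) / 2 ≤ (2 * n - 1) / 2 := by
  have hn : (1 : ℝ) ≤ n := by exact_mod_cast (one_le : 1 ≤ n)
  linarith

lemma oddHalf_le (n : ℕ+) : (2 * n - 1) / 2 ≤ (n : ℝ) := by linarith

section Summability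

variable (k : ℕ) {y : ℝ} (hy : y ≠ 0)

include hy

lemma summable_csch :
    Summable fun n : ℕ+ => (-1 : ℝ) ^ (n : ℕ) * (n : ℝ) ^ k / sinh (n * y) :=
  expDecay_csch.summable_of_ne (fun u => by simp) (abs_coeff_le k) half_le_pnat hy

lemma summable_sech :
    Summable fun n : ℕ+ => (-1 : ℝ) ^ (n : ℕ) * (n : ℝ) ^ k / cosh (n * y) :=
  expDecay_sech.summable_of_ne (fun u => by simp) (abs_coeff_le k) half_le_pnat hy

lemma summable_cothCsch :
    Summable fun n : ℕ+ => (-1 : ℝ) ^ (n : ℕ) * (n : ℝ) ^ k * cosh (n * y) / sinh (n * y) ^ 2 :=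
  (expDecay_csch_deriv.summable_of_ne (fun u => by simp) (abs_coeff_le k) half_le_pnat hy).congr
    fun n => by ring

lemma summable_tanhSech :
    Summable fun n : ℕ+ => (-1 : ℝ) ^ (n : ℕ) * (n : ℝ) ^ k * sinh (n * y) / cosh (n * y) ^ 2 :=
  (expDecay_sech_deriv.summable_of_ne (fun u => by simp [neg_div]) (abs_coeff_le k) half_le_pnat
    hy).congr fun n => by ring

lemma summable_oddCsch : Summable fun n : ℕ+ =>
    (-1 : ℝ) ^ (n : ℕ) * (2 * (n : ℝ) - 1) ^ k / sinh ((2 * n - 1) * y / 2) :=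
  (expDecay_csch.summable_of_ne (fun u => by simp) (abs_oddCoeff_le k) half_le_oddHalf hy).congr
    fun n => by rw [div_mul_eq_mul_div, ← div_eq_mul_inv]

lemma summable_oddSech : Summable fun n : ℕ+ =>
    (-1 : ℝ) ^ (n : ℕ) * (2 * (n : ℝ) - 1) ^ k / cosh ((2 * n - 1) * y / 2) :=
  (expDecay_sech.summable_of_ne (fun u => by simp) (abs_oddCoeff_le k) half_le_oddHalf hy).congr
    fun n => by rw [div_mul_eq_mul_div, ← div_eq_mul_inv]

lemma summable_oddCothCsch : Summable fun n : ℕ+ =>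
    (-1 : ℝ) ^ (n : ℕ) * (2 * (n : ℝ) - 1) ^ k * cosh ((2 * n - 1) * y / 2) /
      sinh ((2 * n - 1) * y / 2) ^ 2 :=
  (expDecay_csch_deriv.summable_of_ne (fun u => by simp) (abs_oddCoeff_le k) half_le_oddHalf
    hy).congr fun n => by rw [div_mul_eq_mul_div, ← mul_div_assoc]

end Summability

section Parity

variable (k : ℕ) (y : ℝ)

lemma cschSum_neg : cschSum k (-y) = -cschSum k y := by
  simp [cschSum, div_neg, tsum_neg]

lemma sechSum_neg : sechSum k (-y) = sechSum k y := by
  simp [sechSum]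

lemma oddCschSum_neg : oddCschSum k (-y) = -oddCschSum k y := by
  simp [oddCschSum, neg_div, div_neg, tsum_neg]

lemma oddSechSum_neg : oddSechSum k (-y) = oddSechSum k y := by
  simp [oddSechSum, neg_div]

lemma cothCschSum_neg : cothCschSum k (-y) = cothCschSum k y := by
  simp [cothCschSum]

lemma tanhSechSum_neg : tanhSechSum k (-y) = -tanhSechSum k y := by
  simp [tanhSechSum, neg_div, tsum_neg]

lemma oddCothCschSum_neg : oddCothCschSum k (-y) = oddCothCschSum k y := by
  simp [oddCothCschSum, neg_div]

end Parity

lemma hasDerivAt_csch {u : ℝ} (hu : 0 < u) :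
    HasDerivAt (fun u => (sinh u)⁻¹) (-(cosh u / sinh u ^ 2)) u :=
  ((hasDerivAt_sinh u).fun_inv (sinh_pos_iff.2 hu).ne').congr_deriv (by ring)

lemma hasDerivAt_sech (u : ℝ) :
    HasDerivAt (fun u => (cosh u)⁻¹) (-(sinh u / cosh u ^ 2)) u :=
  ((hasDerivAt_cosh u).fun_inv (cosh_pos u).ne').congr_deriv (by ring)

lemma ExpDecay.neg {f : ℝ → ℝ} (hf : ExpDecay f) : ExpDecay fun u => -f u := by
  simpa [ExpDecay] using hf

lemma hasDerivAt_cschSum (k : ℕ) {y : ℝ} (hy : 0 < y) :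
    HasDerivAt (cschSum k) (-cothCschSum (k + 1) y) y := by
  refine (expDecay_csch.hasDerivAt_tsum expDecay_csch_deriv.neg (fun u hu => hasDerivAt_csch hu)
    (abs_coeff_le k) half_le_pnat (fun n => le_rfl) hy).congr_deriv ?_
  rw [cothCschSum, ← tsum_neg]
  exact tsum_congr fun n => by ring

lemma hasDerivAt_sechSum (k : ℕ) {y : ℝ} (hy : 0 < y) :
    HasDerivAt (sechSum k) (-tanhSechSum (k + 1) y) y := by
  refine (expDecay_sech.hasDerivAt_tsum expDecay_sech_deriv.neg (fun u _ => hasDerivAt_sech u)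
    (abs_coeff_le k) half_le_pnat (fun n => le_rfl) hy).congr_deriv ?_
  rw [tanhSechSum, ← tsum_neg]
  exact tsum_congr fun n => by ring

/-- The frequency is `(2 n - 1) / 2` while the coefficient is a power of `2 n - 1`, which leaves the
factor `1 / 2`. -/
lemma hasDerivAt_oddCschSum (k : ℕ) {y : ℝ} (hy : 0 < y) :
    HasDerivAt (oddCschSum k) (-(oddCothCschSum (k + 1) y / 2)) y := by
  have := expDecay_csch.hasDerivAt_tsum expDecay_csch_deriv.neg (fun u hu => hasDerivAt_csch hu)
    (abs_oddCoeff_le k) half_le_oddHalf oddHalf_le hy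
  have h : oddCschSum k = fun x => ∑' n : ℕ+, (-1 : ℝ) ^ (n : ℕ) * (2 * (n : ℝ) - 1) ^ k *
      (sinh ((2 * n - 1) / 2 * x))⁻¹ := by
    funext x
    exact tsum_congr fun n => by rw [div_mul_eq_mul_div, ← div_eq_mul_inv]
  rw [h]
  refine this.congr_deriv ?_
  rw [oddCothCschSum, ← tsum_div_const, ← tsum_neg]
  exact tsum_congr fun n => by rw [div_mul_eq_mul_div]; ring

/-! ### Twisted Eisenstein series over the odd lattice -/

/-- The general term of an Eisenstein series over the points `x + y t i` with `x`, `y` odd. -/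
noncomputable def oddLatticeTerm (ε δ : ℝ) (w : ℕ) (t : ℝ) (p : ℤ × ℤ) : ℂ :=
  (ε : ℂ) ^ p.1 * (δ : ℂ) ^ p.2 / ((2 * p.1 + 1) + (2 * p.2 + 1) * (t * Complex.I)) ^ w

/-- The Eisenstein series over the points `x + y t i` with `x`, `y` odd, twisted by signs. -/
noncomputable def oddLatticeSum (ε δ : ℝ) (w : ℕ) (t : ℝ) : ℂ := ∑' p, oddLatticeTerm ε δ w t p

/-- The sum over one row of the odd lattice. -/
noncomputable def oddRowSum (ε : ℝ) (w : ℕ) (s : ℝ) : ℂ :=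
  ∑' a : ℤ, (ε : ℂ) ^ a / ((2 * a + 1) + s * Complex.I) ^ w

lemma zpow_neg_one_sub_of_sq_eq_one {ε : ℝ} (hε : ε * ε = 1) (a : ℤ) :
    (ε : ℂ) ^ (-1 - a) = ε * (ε : ℂ) ^ a := by
  have h : (ε : ℂ) * ε = 1 := by exact_mod_cast hε
  have h0 : (ε : ℂ) ≠ 0 := left_ne_zero_of_mul_eq_one h
  have hi : (ε : ℂ)⁻¹ = ε := inv_eq_of_mul_eq_one_right h
  rw [zpow_sub₀ h0, zpow_neg_one, hi, div_eq_mul_inv, ← inv_zpow, hi]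

lemma abs_eq_one_of_sq_eq_one {ε : ℝ} (hε : ε * ε = 1) : |ε| = 1 := by
  rcases mul_self_eq_one_iff.1 hε with h | h <;> simp [h]

/-- The twists have modulus one, so the norms form a subfamily of those of the full Eisenstein
series at `t i`. -/
lemma summable_oddLatticeTerm {ε δ : ℝ} (hε : ε * ε = 1) (hδ : δ * δ = 1) {w : ℕ} (hw : 3 ≤ w)
    {t : ℝ} (ht : 0 < t) : Summable (oddLatticeTerm ε δ w t) := by
  let z : UpperHalfPlane := ⟨t * Complex.I, by simpa using ht⟩
  have hinj : Function.Injective fun p : ℤ × ℤ => ((2 * p.2 + 1, 2 * p.1 + 1) : ℤ × ℤ) := by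
    rintro ⟨a, b⟩ ⟨c, d⟩ h
    simp only [Prod.mk.injEq] at h ⊢
    omega
  refine Summable.of_norm ((((summable_prod_eisSummand hw z).comp_injective hinj).norm).congr ?_)
  intro p
  have hz : (z : ℂ) = t * Complex.I := rfl
  simp [EisensteinSeries.eisSummand, oddLatticeTerm, abs_eq_one_of_sq_eq_one hε,
    abs_eq_one_of_sq_eq_one hδ, hz, add_comm]

/-- Reflecting the odd lattice exchanges its two coordinates. -/
lemma oddLatticeSum_swap {ε : ℝ} (hε : ε * ε = 1) (δ : ℝ) (w : ℕ) {t : ℝ} (ht : 0 < t) :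
    oddLatticeSum ε δ w t = ε / (t * Complex.I) ^ w * oddLatticeSum δ ε w (1 / t) := by
  -- On odd coordinates this is `(x, y) ↦ (y, -x)`, because `a ↦ -1 - a` negates `2 a + 1`; and `x +
  -- y t i = t i (y - x i / t)`.
  let e : ℤ × ℤ ≃ ℤ × ℤ :=
    { toFun := fun p => (p.2, -1 - p.1)
      invFun := fun p => (-1 - p.2, p.1)
      left_inv := fun p => by simp
      right_inv := fun p => by simp }
  have ht' : (t : ℂ) ≠ 0 := by exact_mod_cast ht.ne'
  rw [oddLatticeSum, oddLatticeSum, ← e.tsum_eq (oddLatticeTerm δ ε w (1 / t)), ← tsum_mul_left]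
  refine tsum_congr fun p => ?_
  have h : (ε : ℂ) * ε = 1 := by exact_mod_cast hε
  simp only [oddLatticeTerm, e, Equiv.coe_fn_mk, zpow_neg_one_sub_of_sq_eq_one hε]
  rw [div_mul_div_comm, ← mul_pow]
  congr 1
  · linear_combination (-(ε : ℂ) ^ p.1 * (δ : ℂ) ^ p.2) * h
  · congr 1
    push_cast
    field_simp
    linear_combination (2 * (p.1 : ℂ) + 1) * Complex.I_sq

lemma oddRowSum_neg {ε : ℝ} (hε : ε * ε = 1) (w : ℕ) (s : ℝ) :
    oddRowSum ε w (-s) = ε * (-1) ^ w * oddRowSum ε w s := by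
  rw [oddRowSum, oddRowSum, ← (Equiv.subLeft (-1 : ℤ)).tsum_eq, ← tsum_mul_left]
  refine tsum_congr fun a => ?_
  simp only [Equiv.subLeft_apply, zpow_neg_one_sub_of_sq_eq_one hε]
  have : (2 * ((-1 - a : ℤ) : ℂ) + 1 + ((-s : ℝ) : ℂ) * Complex.I) =
      -1 * (2 * a + 1 + s * Complex.I) := by push_cast; ring
  rw [this, mul_pow]
  rcases neg_one_pow_eq_or ℂ w with h | h <;> rw [h] <;> ring

/-- The odd lattice sum as a sum over rows in the upper half-plane. -/
lemma oddLatticeSum_eq_rows {ε δ : ℝ} (hε : ε * ε = 1) (hδ : δ * δ = 1) {w : ℕ} (hw : 3 ≤ w)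
    (hp : ε * δ * (-1) ^ w = 1) {t : ℝ} (ht : 0 < t) :
    oddLatticeSum ε δ w t = 2 * ∑' b : ℕ, (δ : ℂ) ^ b * oddRowSum ε w ((2 * b + 1) * t) := by
  have hs := summable_oddLatticeTerm hε hδ hw ht
  have hsw : Summable fun p : ℤ × ℤ => oddLatticeTerm ε δ w t (p.2, p.1) :=
    hs.comp_injective Prod.swap_injective
  have hrow : ∀ b : ℤ, ∑' a, oddLatticeTerm ε δ w t (a, b) =
      (δ : ℂ) ^ b * oddRowSum ε w ((2 * b + 1) * t) := by
    intro b
    rw [oddRowSum, ← tsum_mul_left]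
    refine tsum_congr fun a => ?_
    simp only [oddLatticeTerm]
    push_cast
    ring
  set F : ℤ → ℂ := fun b => (δ : ℂ) ^ b * oddRowSum ε w ((2 * b + 1) * t) with hF
  have h1 : oddLatticeSum ε δ w t = ∑' b, F b := by
    rw [oddLatticeSum, ← (Equiv.prodComm ℤ ℤ).tsum_eq (oddLatticeTerm ε δ w t)]
    have h2 : ∑' p : ℤ × ℤ, oddLatticeTerm ε δ w t (Equiv.prodComm ℤ ℤ p) =
        ∑' (b : ℤ) (a : ℤ), oddLatticeTerm ε δ w t (a, b) := Summable.tsum_prod hsw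
    rw [h2]
    exact tsum_congr hrow
  have hrs : Summable F := (Summable.prod hsw).congr hrow
  have hp' : (ε : ℂ) * δ * (-1) ^ w = 1 := by exact_mod_cast hp
  have hs₁ : Summable fun n : ℕ => F n := hrs.comp_injective Nat.cast_injective
  have hs₂ : Summable fun n : ℕ => F (-((n : ℤ) + 1)) :=
    hrs.comp_injective (i := fun n : ℕ => (-((n : ℤ) + 1))) fun a b h => by
      simp only [neg_inj, add_left_inj, Nat.cast_inj] at h
      exact h
  -- Rows `b` and `-1 - b` lie at opposite heights; the sign condition `hp` makes them contribute
  -- equally instead of cancelling.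
  rw [h1, tsum_of_nat_of_neg_add_one hs₁ hs₂, two_mul]
  refine congrArg₂ (· + ·) (tsum_congr fun n => by simp [hF]) (tsum_congr fun n => ?_)
  simp only [hF]
  rw [show (-((n : ℤ) + 1)) = -1 - n by ring, zpow_neg_one_sub_of_sq_eq_one hδ,
      show (2 * ((-1 - (n : ℤ) : ℤ) : ℝ) + 1) * t = -((2 * n + 1) * t) by push_cast; ring,
      oddRowSum_neg hε, zpow_natCast]
  linear_combination ((δ : ℂ) ^ n * oddRowSum ε w ((2 * n + 1) * t)) * hp'

/-! ### Summation over the rows by geometric series -/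

section Interchange

variable {c l : ℕ+ → ℝ} {A : ℝ} {k : ℕ}

/-- Summing a family of geometric progressions first along the progressions. -/
lemma tsum_geometric_interchange {δ : ℝ} (hδ : δ * δ = 1) {g : ℝ → ℝ}
    (hg : ∀ u > 0, HasSum (fun b : ℕ => δ ^ b * exp (-((2 * b + 1) * u))) (g u))
    (hc : ∀ n, |c n| ≤ A * (n : ℝ) ^ k) (hl : ∀ n : ℕ+, (n : ℝ) / 2 ≤ l n) {y : ℝ} (hy : 0 < y) :
    ∑' b : ℕ, δ ^ b * ∑' n, c n * exp (-(l n * ((2 * b + 1) * y))) = ∑' n, c n * g (l n * y) := by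
  have hA : 0 ≤ A := by simpa using (abs_nonneg _).trans (hc 1)
  have hδ' := abs_eq_one_of_sq_eq_one hδ
  have hgeo : Summable fun b : ℕ => exp (-(y * b)) :=
    (summable_pow_mul_exp_neg_nat_mul 0 hy).congr fun b => by simp
  have hsum : Summable (Function.uncurry fun (n : ℕ+) (b : ℕ) =>
      δ ^ b * (c n * exp (-(l n * ((2 * b + 1) * y))))) := by
    refine Summable.of_norm_bounded (((summable_pnat_pow_mul_exp k (half_pos hy)).mul_left
      A).mul_of_nonneg hgeo (fun n => by positivity) fun b => by positivity) ?_
    rintro ⟨n, b⟩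
    have hn : (1 : ℝ) ≤ n := by exact_mod_cast (one_le : 1 ≤ n)
    have hb : (0 : ℝ) ≤ b := b.cast_nonneg
    simp only [Function.uncurry_apply_pair, norm_mul, norm_pow, norm_eq_abs, hδ', one_pow, one_mul,
      abs_exp]
    rw [← mul_assoc A, mul_assoc (A * _), ← exp_add]
    refine mul_le_mul (hc n) (exp_le_exp.2 ?_) (exp_pos _).le (by positivity)
    -- Uses `l n ≥ n / 2 ≥ 1 / 2`. It separates `n` from `b`, so a product of two one-variable
    -- series dominates.
    have h1 : (n : ℝ) / 2 + b ≤ l n * (2 * b + 1) := by nlinarith [hl n]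
    nlinarith
  calc ∑' b : ℕ, δ ^ b * ∑' n, c n * exp (-(l n * ((2 * b + 1) * y)))
      = ∑' (b : ℕ) (n : ℕ+), δ ^ b * (c n * exp (-(l n * ((2 * b + 1) * y)))) :=
        tsum_congr fun b => tsum_mul_left.symm
    _ = ∑' (n : ℕ+) (b : ℕ), δ ^ b * (c n * exp (-(l n * ((2 * b + 1) * y)))) := hsum.tsum_comm
    _ = _ := tsum_congr fun n => by
        have h0 : 0 < l n := lt_of_lt_of_le (by positivity) (hl n)
        rw [← (hg (l n * y) (by positivity)).tsum_eq, ← tsum_mul_left]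
        exact tsum_congr fun b => by ring_nf

end Interchange

/-- A geometric series of ratio `δ exp (-2 u)`; `δ = 1` and `δ = -1` yield half of `csch` and half
of `sech`. -/
lemma hasSum_odd_exp {δ u : ℝ} (hδ : |δ| = 1) (hu : 0 < u) :
    HasSum (fun b : ℕ => δ ^ b * exp (-((2 * b + 1) * u))) (exp u - δ * exp (-u))⁻¹ := by
  have h1 : exp (-(2 * u)) < 1 := by
    have := exp_lt_exp.2 (show -(2 * u) < 0 by linarith)
    rwa [exp_zero] at this
  have h2 : |δ * exp (-(2 * u))| < 1 := by rwa [abs_mul, hδ, one_mul, abs_exp]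
  have h3 : exp (-u) * (1 - δ * exp (-(2 * u)))⁻¹ = (exp u - δ * exp (-u))⁻¹ := by
    rw [exp_neg u, ← mul_inv, mul_sub, mul_one, show -(2 * u) = -u + -u by ring, exp_add, exp_neg]
    field_simp
  rw [← h3]
  refine ((hasSum_geometric_of_abs_lt_one h2).mul_left (exp (-u))).congr_fun fun b => ?_
  rw [mul_pow, ← exp_nat_mul, mul_left_comm, ← exp_add]
  ring_nf

lemma hasSum_half_csch (u : ℝ) (hu : 0 < u) :
    HasSum (fun b : ℕ => (1 : ℝ) ^ b * exp (-((2 * b + 1) * u))) ((sinh u)⁻¹ / 2) := by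
  have h : (sinh u)⁻¹ / 2 = (exp u - 1 * exp (-u))⁻¹ := by
    rw [sinh_eq, inv_div, div_div_cancel_left' two_ne_zero, one_mul]
  rw [h]
  exact hasSum_odd_exp (by simp) hu

lemma hasSum_half_sech (u : ℝ) (hu : 0 < u) :
    HasSum (fun b : ℕ => (-1 : ℝ) ^ b * exp (-((2 * b + 1) * u))) ((cosh u)⁻¹ / 2) := by
  have h : (cosh u)⁻¹ / 2 = (exp u - -1 * exp (-u))⁻¹ := by
    rw [cosh_eq, inv_div, div_div_cancel_left' two_ne_zero, neg_one_mul, sub_neg_eq_add]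
  rw [h]
  exact hasSum_odd_exp (by simp) hu

/-- An odd lattice sum whose rows expand in exponentials. -/
lemma oddLatticeSum_eq_of_row {ε δ : ℝ} (hε : ε * ε = 1) (hδ : δ * δ = 1) {w : ℕ} (hw : 3 ≤ w)
    (hp : ε * δ * (-1) ^ w = 1) {c l : ℕ+ → ℝ} {A : ℝ} {k : ℕ} {K : ℂ} {g : ℝ → ℝ}
    (hrow : ∀ s > 0, oddRowSum ε w s = K * ((∑' n, c n * exp (-(l n * (π * s))) : ℝ) : ℂ))
    (hg : ∀ u > 0, HasSum (fun b : ℕ => δ ^ b * exp (-((2 * b + 1) * u))) (g u / 2))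
    (hc : ∀ n, |c n| ≤ A * (n : ℝ) ^ k) (hl : ∀ n : ℕ+, (n : ℝ) / 2 ≤ l n) {t : ℝ} (ht : 0 < t) :
    oddLatticeSum ε δ w t = K * ((∑' n, c n * g (l n * (π * t)) : ℝ) : ℂ) := by
  have h1 := tsum_geometric_interchange hδ hg hc hl (mul_pos pi_pos ht)
  have h2 : ∑' n, c n * (g (l n * (π * t)) / 2) = (∑' n, c n * g (l n * (π * t))) / 2 := by
    rw [← tsum_div_const]
    exact tsum_congr fun n => by ring
  have h3 : ∑' b : ℕ, (δ : ℂ) ^ b * oddRowSum ε w ((2 * b + 1) * t) =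
      K * ((∑' b : ℕ, δ ^ b * ∑' n, c n * exp (-(l n * ((2 * b + 1) * (π * t)))) : ℝ) : ℂ) := by
    rw [Complex.ofReal_tsum, ← tsum_mul_left]
    refine tsum_congr fun b => ?_
    rw [hrow _ (by positivity), Complex.ofReal_mul, Complex.ofReal_pow,
      mul_left_comm π, mul_left_comm]
  rw [oddLatticeSum_eq_rows hε hδ hw hp ht, h3, h1, h2]
  push_cast
  ring

/-! ### Row sums by the Lipschitz formula -/

lemma tsum_pnat_even_add_odd {M : Type*} [NormedAddCommGroup M] [CompleteSpace M]
    {f : ℕ → M} (hf : Summable f) :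
    ∑' n : ℕ+, f n = ∑' n : ℕ+, f (2 * n) + ∑' n : ℕ+, f (2 * n - 1) := by
  have h := tsum_even_add_odd (f := fun n => f (n + 1))
    (hf.comp_injective (i := fun k : ℕ => 2 * k + 1) fun a b h => by simpa using h)
    (hf.comp_injective (i := fun k : ℕ => 2 * k + 1 + 1) fun a b h => by simpa using h)
  rw [tsum_pnat_eq_tsum_succ (f := f), tsum_pnat_eq_tsum_succ (f := fun n => f (2 * n)),
    tsum_pnat_eq_tsum_succ (f := fun n => f (2 * n - 1)), ← h, add_comm]
  congr 1

/-- An alternating sum over `ℤ` in terms of the even terms and all terms. -/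
lemma tsum_int_alternating {f : ℤ → ℂ} (hf : Summable f) :
    ∑' a : ℤ, (-1 : ℂ) ^ a * f a = 2 * ∑' a : ℤ, f (2 * a) - ∑' a : ℤ, f a := by
  have hinj : Function.Injective fun a : ℤ => 2 * a := fun a b h => by simpa using h
  -- `(1 + (-1) ^ a) / 2` is the indicator of the even integers.
  have h1 : ∑' a : ℤ, f (2 * a) = ∑' a : ℤ, (f a + (-1 : ℂ) ^ a * f a) / 2 := by
    refine Eq.trans (tsum_congr fun a => ?_)
      (hinj.tsum_eq (f := fun a => (f a + (-1 : ℂ) ^ a * f a) / 2) ?_)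
    · simp [zpow_mul]
    · intro a ha
      by_contra h
      have ho : Odd a := by
        rw [← Int.not_even_iff_odd]
        rintro ⟨b, hb⟩
        exact h ⟨b, by simp only; omega⟩
      exact ha (by simp [ho.neg_one_zpow])
  have hf' : Summable fun a : ℤ => (-1 : ℂ) ^ a * f a := by
    refine Summable.of_norm (hf.norm.congr fun a => ?_)
    simp
  rw [h1, tsum_div_const, hf.tsum_add hf']
  ring

lemma summable_int_row (w : ℕ) (hw : 2 ≤ w) {s : ℝ} (hs : 0 < s) :
    Summable fun a : ℤ => 1 / ((2 * a + 1) + s * Complex.I) ^ w := by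
  let z : UpperHalfPlane := ⟨(1 + s * Complex.I) / 2, by simpa using hs⟩
  have h := (EisensteinSeries.linear_right_summable z 1 (k := w) (by exact_mod_cast hw)).mul_left
    (1 / 2 ^ w : ℂ)
  refine h.congr fun a => ?_
  have hz : (z : ℂ) = (1 + s * Complex.I) / 2 := rfl
  rw [zpow_natCast, hz, ← one_div, div_mul_div_comm, ← mul_pow]
  congr 2
  · simp
  · push_cast; ring

lemma cexp_half_add (s : ℝ) :
    Complex.exp (2 * π * Complex.I * ((1 + s * Complex.I) / 2)) = -(exp (-(π * s)) : ℝ) := by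
  rw [show 2 * π * Complex.I * ((1 + s * Complex.I) / 2) =
    π * Complex.I + ((-(π * s) : ℝ) : ℂ) by
      push_cast; linear_combination (π * s : ℂ) * Complex.I_sq,
    Complex.exp_add, Complex.exp_pi_mul_I, Complex.ofReal_exp]
  ring

lemma cexp_quarter_add (s : ℝ) :
    Complex.exp (2 * π * Complex.I * ((1 + s * Complex.I) / 4)) =
      Complex.I * (exp (-(π * s / 2)) : ℝ) := by
  rw [show 2 * π * Complex.I * ((1 + s * Complex.I) / 4) =
    π / 2 * Complex.I + ((-(π * s / 2) : ℝ) : ℂ) by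
      push_cast; linear_combination (π * s / 2 : ℂ) * Complex.I_sq,
    Complex.exp_add, Complex.exp_pi_div_two_mul_I, Complex.ofReal_exp]

/-- With `z = (1 + s i) / 2` the row is `2 (z + a)`, and the nome at `z` is `-exp (-π s)`, whence
the alternating sign. -/
lemma oddRowSum_one {k : ℕ} (hk : 1 ≤ k) {s : ℝ} (hs : 0 < s) :
    oddRowSum 1 (k + 1) s = (-(π * Complex.I)) ^ (k + 1) / k.factorial *
      ((∑' n : ℕ+, (-1) ^ (n : ℕ) * (n : ℝ) ^ k * exp (-(n * (π * s))) : ℝ) : ℂ) := by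
  have h := EisensteinSeries.qExpansion_identity_pnat hk
    ⟨(1 + s * Complex.I) / 2, by simpa using hs⟩
  simp only [cexp_half_add] at h
  have h1 : oddRowSum 1 (k + 1) s =
      1 / 2 ^ (k + 1) * ∑' n : ℤ, 1 / ((1 + s * Complex.I) / 2 + n) ^ (k + 1) := by
    rw [oddRowSum, ← tsum_mul_left]
    refine tsum_congr fun a => ?_
    rw [div_mul_div_comm, ← mul_pow]
    congr 2
    · simp
    · ring
  rw [h1, h, Complex.ofReal_tsum, ← mul_assoc]
  congr 1
  · rw [← mul_div_assoc, ← one_div_pow, ← mul_pow]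
    ring
  · refine tsum_congr fun n => ?_
    rw [neg_pow, ← Complex.ofReal_pow, ← exp_nat_mul]
    push_cast
    ring_nf

/-- The twisted row is twice its even-indexed part minus the untwisted row. The even-indexed part is
`4 (z + a)` with `z = (1 + s i) / 4`, whose nome is `i exp (-π s / 2)`. The even powers of this nome
cancel against the untwisted row; the odd ones remain, with `i ^ (2 n - 1) = -i (-1) ^ n`. -/
lemma oddRowSum_neg_one {k : ℕ} (hk : 1 ≤ k) {s : ℝ} (hs : 0 < s) :
    oddRowSum (-1) (k + 1) s =
      (-(π * Complex.I / 2)) ^ (k + 1) / k.factorial * (-2 * Complex.I) *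
      ((∑' n : ℕ+, (-1) ^ (n : ℕ) * (2 * (n : ℝ) - 1) ^ k *
        exp (-((2 * n - 1) / 2 * (π * s))) : ℝ) : ℂ) := by
  have h := EisensteinSeries.qExpansion_identity_pnat hk
    ⟨(1 + s * Complex.I) / 4, by simpa using hs⟩
  simp only [cexp_quarter_add] at h
  have h1 : ∑' a : ℤ, 1 / (((2 * (2 * a : ℤ) : ℂ) + 1) + s * Complex.I) ^ (k + 1) =
      1 / 4 ^ (k + 1) * ∑' n : ℤ, 1 / ((1 + s * Complex.I) / 4 + n) ^ (k + 1) := by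
    rw [← tsum_mul_left]
    refine tsum_congr fun a => ?_
    rw [div_mul_div_comm, ← mul_pow]
    congr 2
    · simp
    · push_cast; ring
  have h2 : oddRowSum (-1) (k + 1) s =
      2 * ∑' a : ℤ, 1 / (((2 * (2 * a : ℤ) : ℂ) + 1) + s * Complex.I) ^ (k + 1) -
        oddRowSum 1 (k + 1) s := by
    have := tsum_int_alternating (summable_int_row (k + 1) (by omega) hs)
    simpa [oddRowSum, div_eq_mul_inv] using this
  set x : ℝ := exp (-(π * s / 2)) with hx
  have hsum : Summable fun n : ℕ => (n : ℂ) ^ k * (Complex.I * x) ^ n := by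
    refine summable_pow_mul_geometric_of_norm_lt_one k ?_
    have := exp_lt_exp.2 (show -(π * s / 2) < 0 by have := mul_pos pi_pos hs; linarith)
    rw [exp_zero] at this
    rwa [norm_mul, Complex.norm_I, one_mul, Complex.norm_real, norm_eq_abs, hx, abs_exp]
  have h3 := tsum_pnat_even_add_odd hsum
  have h4 : (((∑' n : ℕ+, (-1) ^ (n : ℕ) * (n : ℝ) ^ k * exp (-(n * (π * s))) : ℝ) : ℂ)) =
      1 / 2 ^ k * ∑' n : ℕ+, ((2 * n : ℕ) : ℂ) ^ k * (Complex.I * x) ^ (2 * n : ℕ) := by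
    rw [Complex.ofReal_tsum, ← tsum_mul_left]
    refine tsum_congr fun n => ?_
    rw [pow_mul, mul_pow, Complex.I_sq, neg_one_mul, neg_pow ((x : ℂ) ^ 2), ← Complex.ofReal_pow,
      ← Complex.ofReal_pow, hx, ← exp_nat_mul, ← exp_nat_mul]
    push_cast
    rw [mul_pow]
    field_simp
  have h5 : ∑' n : ℕ+, ((2 * n - 1 : ℕ) : ℂ) ^ k * (Complex.I * x) ^ (2 * n - 1 : ℕ) =
      -Complex.I * ((∑' n : ℕ+, (-1) ^ (n : ℕ) * (2 * (n : ℝ) - 1) ^ k *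
        exp (-((2 * n - 1) / 2 * (π * s))) : ℝ) : ℂ) := by
    rw [Complex.ofReal_tsum, ← tsum_mul_left]
    refine tsum_congr fun n => ?_
    obtain ⟨m, hm⟩ : ∃ m : ℕ, (n : ℕ) = m + 1 := ⟨n - 1, by have := n.pos; omega⟩
    have hm' : (2 * (n : ℕ) - 1) = 2 * m + 1 := by omega
    rw [hm', mul_pow, pow_succ Complex.I, pow_mul, Complex.I_sq, ← Complex.ofReal_pow, hx,
      ← exp_nat_mul, hm]
    push_cast
    ring_nf
  rw [h2, h1, h, h3, oddRowSum_one hk hs, h4, h5]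
  generalize (∑' n : ℕ+, ((2 * n : ℕ) : ℂ) ^ k * (Complex.I * x) ^ (2 * n : ℕ)) = U
  generalize ((∑' n : ℕ+, (-1) ^ (n : ℕ) * (2 * (n : ℝ) - 1) ^ k *
    exp (-((2 * n - 1) / 2 * (π * s))) : ℝ) : ℂ) = V
  rw [show (-2 * (π : ℂ) * Complex.I) = 4 * (-(π * Complex.I / 2)) by ring,
    show (-((π : ℂ) * Complex.I)) = 2 * (-(π * Complex.I / 2)) by ring, mul_pow, mul_pow]
  field_simp
  ring

/-! ### Lattice sums as hyperbolic series -/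

section LatticeValues

variable {k : ℕ} {t : ℝ} (ht : 0 < t)
include ht

lemma oddLatticeSum_one_one (hk : 2 ≤ k) (hodd : Odd k) : oddLatticeSum 1 1 (k + 1) t =
    (-(π * Complex.I)) ^ (k + 1) / k.factorial * (cschSum k (π * t) : ℝ) :=
  oddLatticeSum_eq_of_row (by simp) (by simp) (by omega) (by simp [hodd.add_one.neg_one_pow])
    (fun _ hs => oddRowSum_one (by omega) hs) hasSum_half_csch (abs_coeff_le k) half_le_pnat ht

lemma oddLatticeSum_one_neg_one (hk : 2 ≤ k) (heven : Even k) :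
    oddLatticeSum 1 (-1) (k + 1) t =
      (-(π * Complex.I)) ^ (k + 1) / k.factorial * (sechSum k (π * t) : ℝ) :=
  oddLatticeSum_eq_of_row (by simp) (by simp) (by omega) (by simp [heven.add_one.neg_one_pow])
    (fun _ hs => oddRowSum_one (by omega) hs) hasSum_half_sech (abs_coeff_le k) half_le_pnat ht

lemma oddLatticeSum_neg_one_one (hk : 2 ≤ k) (heven : Even k) :
    oddLatticeSum (-1) 1 (k + 1) t =
      (-(π * Complex.I / 2)) ^ (k + 1) / k.factorial * (-2 * Complex.I) *
        (oddCschSum k (π * t) : ℝ) := by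
  rw [oddLatticeSum_eq_of_row (by simp) (by simp) (by omega) (by simp [heven.add_one.neg_one_pow])
    (fun _ hs => oddRowSum_neg_one (by omega) hs) hasSum_half_csch (abs_oddCoeff_le k)
    half_le_oddHalf ht, oddCschSum]
  simp only [div_mul_eq_mul_div, ← div_eq_mul_inv]

lemma oddLatticeSum_neg_one_neg_one (hk : 2 ≤ k) (hodd : Odd k) :
    oddLatticeSum (-1) (-1) (k + 1) t =
      (-(π * Complex.I / 2)) ^ (k + 1) / k.factorial * (-2 * Complex.I) *
        (oddSechSum k (π * t) : ℝ) := by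
  rw [oddLatticeSum_eq_of_row (by simp) (by simp) (by omega) (by simp [hodd.add_one.neg_one_pow])
    (fun _ hs => oddRowSum_neg_one (by omega) hs) hasSum_half_sech (abs_oddCoeff_le k)
    half_le_oddHalf ht, oddSechSum]
  simp only [div_mul_eq_mul_div, ← div_eq_mul_inv]

end LatticeValues

/-! ### Functional equations under `y ↦ π² / y` -/

section Transformation

variable {y : ℝ} (hy : 0 < y)
include hy

omit hy in
lemma pi_mul_div_pi (y : ℝ) : π * (y / π) = y := by field_simp

omit hy in
lemma pi_mul_one_div_div_pi (y : ℝ) : π * (1 / (y / π)) = π ^ 2 / y := by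
  rw [one_div_div, ← mul_div_assoc, sq]

/-- The twist `(1, 1)` is fixed by the swap. At `t = y / π` the two arguments are `y` and `π² / y`,
and the Lipschitz constant cancels. -/
lemma cschSum_transform_of_pos {m : ℕ} (hm : 1 ≤ m) :
    cschSum (2 * m + 1) y =
      (-1) ^ (m + 1) * (π / y) ^ (2 * m + 2) * cschSum (2 * m + 1) (π ^ 2 / y) := by
  have ht : 0 < y / π := by positivity
  have h := oddLatticeSum_swap (ε := 1) (by simp) 1 (2 * m + 1 + 1) ht
  rw [oddLatticeSum_one_one ht (by omega) (odd_two_mul_add_one m),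
    oddLatticeSum_one_one (one_div_pos.2 ht) (by omega) (odd_two_mul_add_one m),
    pi_mul_div_pi, pi_mul_one_div_div_pi] at h
  have hK : (-(π * Complex.I)) ^ (2 * m + 1 + 1) / ((2 * m + 1).factorial : ℂ) ≠ 0 := by
    simp [pi_ne_zero, Nat.factorial_ne_zero]
  have hI : Complex.I ^ (2 * m + 1 + 1) = (-1) ^ (m + 1) := by
    rw [← Complex.I_sq, ← pow_mul]; ring_nf
  have hs : ((-1 : ℂ) ^ (m + 1)) * (-1) ^ (m + 1) = 1 := by rw [← mul_pow]; simp
  rw [mul_left_comm] at h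
  have h' := mul_left_cancel₀ hK h
  rw [mul_pow, hI] at h'
  have hy' : (y : ℂ) ≠ 0 := by exact_mod_cast hy.ne'
  have hs0 : ((-1 : ℂ) ^ (m + 1)) ≠ 0 := by simp
  have : ((cschSum (2 * m + 1) y : ℝ) : ℂ) =
      (-1) ^ (m + 1) * (π / y) ^ (2 * m + 2) * (cschSum (2 * m + 1) (π ^ 2 / y) : ℝ) := by
    rw [h']
    push_cast
    rw [div_pow, div_pow]
    field_simp
    linear_combination (-((cschSum (2 * m + 1) (π ^ 2 / y) : ℝ) : ℂ)) * hs
  exact_mod_cast this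

/-- The swap takes the twist `(1, -1)` to `(-1, 1)`, hence integer `sech` to odd `csch`. -/
lemma sechSum_transform_of_pos {m : ℕ} (hm : 1 ≤ m) :
    sechSum (2 * m) y =
      (-1) ^ (m + 1) * (π / y) ^ (2 * m + 1) / 2 ^ (2 * m) * oddCschSum (2 * m) (π ^ 2 / y) := by
  have ht : 0 < y / π := by positivity
  have h := oddLatticeSum_swap (ε := 1) (by simp) (-1) (2 * m + 1) ht
  rw [oddLatticeSum_one_neg_one ht (by omega) (even_two_mul m),
    oddLatticeSum_neg_one_one (one_div_pos.2 ht) (by omega) (even_two_mul m),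
    pi_mul_div_pi, pi_mul_one_div_div_pi] at h
  have hK : (-(π * Complex.I)) ^ (2 * m + 1) / ((2 * m).factorial : ℂ) ≠ 0 := by
    simp [pi_ne_zero, Nat.factorial_ne_zero]
  have hI : Complex.I ^ (2 * m + 1) = (-1) ^ m * Complex.I := by
    rw [pow_succ, pow_mul, Complex.I_sq]
  have hs : ((-1 : ℂ) ^ m) * (-1) ^ m = 1 := by rw [← mul_pow]; simp
  -- The two Lipschitz constants differ by `-2 i / 2 ^ (2 m + 1)`; isolating this ratio exposes the
  -- factor to cancel.
  rw [← neg_div, div_pow, show ((1 : ℝ) : ℂ) / (((y / π : ℝ) : ℂ) * Complex.I) ^ (2 * m + 1) *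
    ((-(π * Complex.I)) ^ (2 * m + 1) / 2 ^ (2 * m + 1) / ((2 * m).factorial : ℂ) *
      (-2 * Complex.I) * (oddCschSum (2 * m) (π ^ 2 / y) : ℝ)) =
    (-(π * Complex.I)) ^ (2 * m + 1) / ((2 * m).factorial : ℂ) *
      (1 / (((y / π : ℝ) : ℂ) * Complex.I) ^ (2 * m + 1) / 2 ^ (2 * m + 1) * (-2 * Complex.I) *
        (oddCschSum (2 * m) (π ^ 2 / y) : ℝ)) by push_cast; ring] at h
  have h' := mul_left_cancel₀ hK h
  rw [mul_pow, hI] at h'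
  have hy' : (y : ℂ) ≠ 0 := by exact_mod_cast hy.ne'
  have hs0 : ((-1 : ℂ) ^ m) ≠ 0 := by simp
  have : ((sechSum (2 * m) y : ℝ) : ℂ) =
      (-1) ^ (m + 1) * (π / y) ^ (2 * m + 1) / 2 ^ (2 * m) *
        (oddCschSum (2 * m) (π ^ 2 / y) : ℝ) := by
    rw [h', pow_succ (-1 : ℂ), pow_succ (2 : ℂ)]
    push_cast
    rw [div_pow, div_pow]
    field_simp
    linear_combination ((oddCschSum (2 * m) (π ^ 2 / y) : ℝ) : ℂ) * hs
  exact_mod_cast this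

/-- The twist `(-1, -1)` is fixed, but the prefactor `ε = -1` of the swap reverses the sign found
for `cschSum`. -/
lemma oddSechSum_transform {m : ℕ} (hm : 1 ≤ m) :
    oddSechSum (2 * m + 1) y =
      (-1) ^ m * (π / y) ^ (2 * m + 2) * oddSechSum (2 * m + 1) (π ^ 2 / y) := by
  have ht : 0 < y / π := by positivity
  have h := oddLatticeSum_swap (ε := -1) (by simp) (-1) (2 * m + 1 + 1) ht
  rw [oddLatticeSum_neg_one_neg_one ht (by omega) (odd_two_mul_add_one m),
    oddLatticeSum_neg_one_neg_one (one_div_pos.2 ht) (by omega) (odd_two_mul_add_one m),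
    pi_mul_div_pi, pi_mul_one_div_div_pi] at h
  have hK : (-(π * Complex.I / 2)) ^ (2 * m + 1 + 1) / ((2 * m + 1).factorial : ℂ) *
      (-2 * Complex.I) ≠ 0 := by
    simp [pi_ne_zero, Nat.factorial_ne_zero]
  have hI : Complex.I ^ (2 * m + 1 + 1) = -(-1) ^ m := by
    rw [show 2 * m + 1 + 1 = 2 * (m + 1) by ring, pow_mul, Complex.I_sq, pow_succ]; ring
  have hs : ((-1 : ℂ) ^ m) * (-1) ^ m = 1 := by rw [← mul_pow]; simp
  rw [mul_left_comm (((-1 : ℝ) : ℂ) / _)] at h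
  have h' := mul_left_cancel₀ hK h
  rw [mul_pow, hI] at h'
  have hy' : (y : ℂ) ≠ 0 := by exact_mod_cast hy.ne'
  have hs0 : ((-1 : ℂ) ^ m) ≠ 0 := by simp
  have : ((oddSechSum (2 * m + 1) y : ℝ) : ℂ) =
      (-1) ^ m * (π / y) ^ (2 * m + 2) * (oddSechSum (2 * m + 1) (π ^ 2 / y) : ℝ) := by
    rw [h']
    push_cast
    rw [div_pow, div_pow]
    field_simp
    linear_combination (-((oddSechSum (2 * m + 1) (π ^ 2 / y) : ℝ) : ℂ)) * hs
  exact_mod_cast this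

/-- `y ↦ π² / y` is an involution, so this inverts `sechSum_transform_of_pos`. -/
lemma oddCschSum_transform {m : ℕ} (hm : 1 ≤ m) :
    oddCschSum (2 * m) y =
      (-1) ^ (m + 1) * 2 ^ (2 * m) * (π / y) ^ (2 * m + 1) * sechSum (2 * m) (π ^ 2 / y) := by
  have hY : 0 < π ^ 2 / y := by positivity
  have hs : ((-1 : ℝ) ^ (m + 1)) * (-1) ^ (m + 1) = 1 := by rw [← mul_pow]; simp
  rw [sechSum_transform_of_pos hY hm, show π ^ 2 / (π ^ 2 / y) = y by field_simp,
    show π / (π ^ 2 / y) = (π / y)⁻¹ by field_simp, inv_pow]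
  have h1 : (π / y) ^ (2 * m + 1) ≠ 0 := by positivity
  field_simp
  linear_combination (-oddCschSum (2 * m) y) * hs

end Transformation

/-! ### Weight two, from the quasi-modularity of `G2` -/

/-- The Lambert series of the divisor sum at `exp (-u)`. -/
noncomputable def lambertSum (u : ℝ) : ℝ :=
  ∑' n : ℕ+, (n : ℝ) * exp (-u) ^ (n : ℕ) / (1 - exp (-u) ^ (n : ℕ))

lemma exp_neg_lt_one {u : ℝ} (hu : 0 < u) : exp (-u) < 1 := by
  have := exp_lt_exp.2 (show -u < 0 by linarith)
  rwa [exp_zero] at this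

lemma G2_eq_lambertSum {u : ℝ} (hu : 0 < u) (z : UpperHalfPlane)
    (hz : (z : ℂ) = u / (2 * π) * Complex.I) :
    EisensteinSeries.G2 z = π ^ 2 / 3 * (1 - 24 * (lambertSum u : ℝ)) := by
  have h1 : Complex.exp (2 * π * Complex.I * z) = (exp (-u) : ℝ) := by
    rw [hz, Complex.ofReal_exp]
    congr 1
    have : (π : ℂ) ≠ 0 := by exact_mod_cast pi_ne_zero
    push_cast
    field_simp
    linear_combination (u : ℂ) * Complex.I_sq
  have h2 := tsum_pow_div_one_sub_eq_tsum_sigma (r := exp (-u))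
    (by rw [norm_eq_abs, abs_exp]; exact exp_neg_lt_one hu) 1
  have h3 : lambertSum u = ∑' n : ℕ+, (ArithmeticFunction.sigma 1 n : ℝ) * exp (-u) ^ (n : ℕ) := by
    rw [← h2, lambertSum]; simp
  rw [EisensteinSeries.G2_eq_tsum_cexp, h1, h3, Complex.ofReal_tsum, riemannZeta_two]
  push_cast
  ring

/-- The inversion `z ↦ -1 / z` reads `u ↦ 4 π² / u` at `z = u i / (2 π)`; `12 / u` is the
non-modular term of `G2`. -/
lemma lambertSum_transform {u : ℝ} (hu : 0 < u) :
    1 - 24 * lambertSum u =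
      12 / u - 4 * π ^ 2 / u ^ 2 * (1 - 24 * lambertSum (4 * π ^ 2 / u)) := by
  let z : UpperHalfPlane := ⟨u / (2 * π) * Complex.I, by
    rw [show (u / (2 * π) * Complex.I : ℂ) = ((u / (2 * π) : ℝ) : ℂ) * Complex.I by push_cast; rfl]
    rw [Complex.im_ofReal_mul, Complex.I_im]; positivity⟩
  have hπ : (π : ℂ) ≠ 0 := by exact_mod_cast pi_ne_zero
  have hu' : (u : ℂ) ≠ 0 := by exact_mod_cast hu.ne'
  have hz : (z : ℂ) = u / (2 * π) * Complex.I := rfl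
  have h := EisensteinSeries.G2_S_transform z
  rw [G2_eq_lambertSum hu z hz, G2_eq_lambertSum (u := 4 * π ^ 2 / u) (by positivity), hz] at h
  · have h2 : ((1 - 24 * lambertSum u : ℝ) : ℂ) =
      (12 / u - 4 * π ^ 2 / u ^ 2 * (1 - 24 * lambertSum (4 * π ^ 2 / u)) : ℝ) := by
      push_cast
      rw [mul_pow, Complex.I_sq] at h
      field_simp at h ⊢
      linear_combination h
    exact_mod_cast h2
  · rw [UpperHalfPlane.modular_S_smul]
    simp only [hz]
    push_cast
    have hI := Complex.I_ne_zero
    field_simp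
    linear_combination (-4 : ℂ) * Complex.I_sq

lemma summable_lambert {u : ℝ} (hu : 0 < u) : Summable fun n : ℕ+ =>
    (n : ℝ) * exp (-u) ^ (n : ℕ) / (1 - exp (-u) ^ (n : ℕ)) := by
  have h := summable_norm_pow_mul_geometric_div_one_sub (r := exp (-u)) 1
    (by rw [norm_eq_abs, abs_exp]; exact exp_neg_lt_one hu)
  exact (h.comp_injective PNat.coe_injective).congr fun n => by simp

/-- With `q = exp (-n y)`, half of `csch` is `q / (1 - q²) = q / (1 - q) - q² / (1 - q²)`, a
difference of Lambert terms. The alternating sum is twice the even-indexed sum minus the full sum.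
-/
lemma cschSum_one_eq_lambertSum {y : ℝ} (hy : 0 < y) :
    cschSum 1 y = 2 * (5 * lambertSum (2 * y) - lambertSum y - 4 * lambertSum (4 * y)) := by
  set b : ℕ → ℝ := fun n => n * exp (-y) ^ n / (1 - exp (-(2 * y)) ^ n) with hb
  have hx : ∀ n : ℕ+, exp (-y) ^ (n : ℕ) < 1 := fun n =>
    pow_lt_one₀ (exp_pos _).le (exp_neg_lt_one hy) n.ne_zero
  have hsq : ∀ u : ℝ, exp (-(2 * u)) = exp (-u) ^ 2 := fun u => by
    rw [← exp_nat_mul]; push_cast; ring_nf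
  have key : ∀ q : ℝ, 0 < q → q < 1 → q / (1 - q ^ 2) = q / (1 - q) - q ^ 2 / (1 - q ^ 2) := by
    intro q h0 h1
    have h2 : 1 - q ≠ 0 := by linarith
    have h3 : 1 + q ≠ 0 := by linarith
    rw [show 1 - q ^ 2 = (1 - q) * (1 + q) by ring]
    field_simp
    ring
  have h1 : ∀ n : ℕ+, b n = (n : ℝ) * exp (-y) ^ (n : ℕ) / (1 - exp (-y) ^ (n : ℕ)) -
      (n : ℝ) * exp (-(2 * y)) ^ (n : ℕ) / (1 - exp (-(2 * y)) ^ (n : ℕ)) := by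
    intro n
    have := key (exp (-y) ^ (n : ℕ)) (by positivity) (hx n)
    simp only [hb, hsq y, ← pow_mul, mul_comm 2 (n : ℕ), mul_div_assoc] at this ⊢
    rw [this]
    ring
  have h2 : ∀ n : ℕ+, b (2 * n) = 2 * (
      (n : ℝ) * exp (-(2 * y)) ^ (n : ℕ) / (1 - exp (-(2 * y)) ^ (n : ℕ)) -
      (n : ℝ) * exp (-(4 * y)) ^ (n : ℕ) / (1 - exp (-(4 * y)) ^ (n : ℕ))) := by
    intro n
    have h4 : exp (-(4 * y)) = exp (-(2 * y)) ^ 2 := by rw [← hsq]; ring_nf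
    have := key (exp (-(2 * y)) ^ (n : ℕ)) (by positivity)
      (pow_lt_one₀ (exp_pos _).le (exp_neg_lt_one (by positivity)) n.ne_zero)
    simp only [hb, h4, mul_div_assoc, pow_mul (exp (-y)), ← hsq y]
    rw [mul_comm 2 (n : ℕ), pow_mul, this]
    push_cast
    ring
  have hs : Summable fun n : ℕ+ => b n :=
    ((summable_lambert hy).sub (summable_lambert (u := 2 * y) (by positivity))).congr
      fun n => (h1 n).symm
  have hs' : Summable b := by
    rw [← summable_pnat_iff_summable_nat]
    exact hs
  have hsa : Summable fun n : ℕ => (-1 : ℝ) ^ n * b n :=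
    Summable.of_norm (hs'.norm.congr fun n => by simp)
  have e1 := tsum_pnat_even_add_odd hs'
  have e2 := tsum_pnat_even_add_odd hsa
  have e3 : ∑' n : ℕ+, (-1 : ℝ) ^ (2 * (n : ℕ) - 1) * b (2 * n - 1) =
      -∑' n : ℕ+, b (2 * n - 1) := by
    rw [← tsum_neg]
    refine tsum_congr fun n => ?_
    have ho : Odd (2 * (n : ℕ) - 1) := ⟨n - 1, by have := n.pos; omega⟩
    rw [ho.neg_one_pow, neg_one_mul]
  simp only [pow_mul, neg_one_sq, one_pow, one_mul] at e2
  rw [e3] at e2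
  have e4 : ∑' n : ℕ+, b n = lambertSum y - lambertSum (2 * y) := by
    rw [tsum_congr h1]
    exact (summable_lambert hy).tsum_sub (summable_lambert (u := 2 * y) (by positivity))
  have e5 : ∑' n : ℕ+, b (2 * n) = 2 * (lambertSum (2 * y) - lambertSum (4 * y)) := by
    rw [tsum_congr h2, tsum_mul_left]
    congr 1
    exact (summable_lambert (u := 2 * y) (by positivity)).tsum_sub
      (summable_lambert (u := 4 * y) (by positivity))
  have e6 : cschSum 1 y = 2 * ∑' n : ℕ+, (-1 : ℝ) ^ (n : ℕ) * b n := by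
    rw [cschSum, ← tsum_mul_left]
    refine tsum_congr fun n => ?_
    have hn := hx n
    have hpos : 0 < exp (-y) ^ (n : ℕ) := by positivity
    have hsinh : sinh (n * y) = (1 - (exp (-y) ^ (n : ℕ)) ^ 2) / (2 * exp (-y) ^ (n : ℕ)) := by
      rw [sinh_eq, ← mul_neg, exp_nat_mul, exp_nat_mul, exp_neg, inv_pow]
      field_simp
    have hne : 1 - (exp (-y) ^ (n : ℕ)) ^ 2 ≠ 0 := by nlinarith
    rw [hsinh]
    simp only [hb, hsq y, ← pow_mul, mul_comm 2 (n : ℕ)] at hne ⊢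
    field_simp
  rw [e6, e2]
  linarith

/-- Inversion permutes the three Lambert arguments up to the change `y ↦ π² / y`. The constants
cancel in the combination, and the `12 / u` terms add up to `-1 / (2 y)`. -/
lemma cschSum_one_transform {y : ℝ} (hy : 0 < y) :
    cschSum 1 y = -(π / y) ^ 2 * cschSum 1 (π ^ 2 / y) - 1 / (2 * y) := by
  have h1 := lambertSum_transform hy
  have h2 := lambertSum_transform (u := 2 * y) (by positivity)
  have h4 := lambertSum_transform (u := 4 * y) (by positivity)
  rw [show 4 * π ^ 2 / y = 4 * (π ^ 2 / y) by ring] at h1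
  rw [show 4 * π ^ 2 / (2 * y) = 2 * (π ^ 2 / y) by ring] at h2
  rw [show 4 * π ^ 2 / (4 * y) = π ^ 2 / y by field_simp] at h4
  rw [cschSum_one_eq_lambertSum hy, cschSum_one_eq_lambertSum (by positivity)]
  field_simp at h1 h2 h4 ⊢
  linarith

/-! ### Differentiated functional equations -/

lemma hasDerivAt_comp_const_div {f : ℝ → ℝ} {f' a y : ℝ} (hy : y ≠ 0)
    (hf : HasDerivAt f f' (a / y)) :
    HasDerivAt (fun x => f (a / x)) (f' * -(a / y ^ 2)) y := by
  refine hf.comp y (((hasDerivAt_const y a).fun_div (hasDerivAt_id y) hy).congr_deriv ?_)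
  simp [neg_div]

lemma hasDerivAt_const_div_pow (a : ℝ) {y : ℝ} (hy : y ≠ 0) (k : ℕ) :
    HasDerivAt (fun x => (a / x) ^ k) (-(k * (a / y) ^ k / y)) y := by
  refine ((((hasDerivAt_const y a).fun_div (hasDerivAt_id y) hy).fun_pow k)).congr_deriv ?_
  rcases k with _ | k
  · simp
  · simp only [id, Nat.add_sub_cancel, pow_succ]
    field_simp
    simp [mul_comm]

section Derivative

variable {y : ℝ} (hy : 0 < y) {m : ℕ}
include hy

/-- Differentiating a functional equation under `y ↦ π² / y`. -/
lemma deriv_transform {F G : ℝ → ℝ} {F' G' C : ℝ} {k : ℕ}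
    (h : ∀ x > 0, F x = C * (π / x) ^ k * G (π ^ 2 / x)) (hF : HasDerivAt F F' y)
    (hG : HasDerivAt G G' (π ^ 2 / y)) :
    F' = -C * (π / y) ^ k * (k / y * G (π ^ 2 / y) + π ^ 2 / y ^ 2 * G') := by
  have h1 := ((hasDerivAt_const_div_pow π hy.ne' k).const_mul C).fun_mul
    (hasDerivAt_comp_const_div hy.ne' hG)
  -- The equation holds only for positive arguments, but a neighbourhood of `y` suffices to compare
  -- derivatives.
  have h2 : F =ᶠ[nhds y] fun x => C * (π / x) ^ k * G (π ^ 2 / x) :=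
    Filter.eventually_of_mem (Ioi_mem_nhds hy) h
  rw [(h2.hasDerivAt_iff.1 hF).unique h1]
  ring

lemma cothCschSum_transform (hm : 1 ≤ m) :
    cothCschSum (2 * m) y =
      (-1) ^ m * (π / y) ^ (2 * m) * (2 * m / y * cschSum (2 * m - 1) (π ^ 2 / y) -
        π ^ 2 / y ^ 2 * cothCschSum (2 * m) (π ^ 2 / y)) - wConst (2 * m + 1) / (2 * y ^ 2) := by
  have hY : 0 < π ^ 2 / y := by positivity
  obtain ⟨j, rfl⟩ : ∃ j, m = j + 1 := ⟨m - 1, by omega⟩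
  rw [show 2 * (j + 1) - 1 = 2 * j + 1 by omega]
  rcases Nat.eq_zero_or_pos j with rfl | hj
  -- Weight two: moving the anomalous `1 / (2 x)` to the left restores a clean functional equation,
  -- and its derivative is the `wConst` term.
  · have h := deriv_transform hy (F := fun x => cschSum 1 x + 1 / 2 / x) (G := cschSum 1)
      (C := -1) (k := 2)
      (fun x hx => by rw [cschSum_one_transform hx]; field_simp; ring)
      ((hasDerivAt_cschSum 1 hy).add (hasDerivAt_comp_const_div (f := id) (a := 1 / 2) hy.ne'
        (hasDerivAt_id _))) (hasDerivAt_cschSum 1 hY)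
    simp only [wConst]
    norm_num at h ⊢
    rw [← neg_inj]
    linear_combination h
  · have h := deriv_transform hy (fun x hx => cschSum_transform_of_pos hx hj)
      (hasDerivAt_cschSum (2 * j + 1) hy) (hasDerivAt_cschSum (2 * j + 1) hY)
    have hw : wConst (2 * (j + 1) + 1) = 0 := if_neg (by omega)
    rw [hw, show 2 * (j + 1) = 2 * j + 1 + 1 by ring]
    push_cast at h ⊢
    linear_combination -h

lemma tanhSechSum_transform (hm : 1 ≤ m) :
    tanhSechSum (2 * m + 1) y =
      (-1) ^ (m + 1) * (π / y) ^ (2 * m + 1) / 2 ^ (2 * m) *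
        ((2 * m + 1) / y * oddCschSum (2 * m) (π ^ 2 / y) -
          π ^ 2 / (2 * y ^ 2) * oddCothCschSum (2 * m + 1) (π ^ 2 / y)) := by
  have hY : 0 < π ^ 2 / y := by positivity
  have h := deriv_transform hy (C := (-1) ^ (m + 1) / 2 ^ (2 * m)) (k := 2 * m + 1)
    (fun x hx => (sechSum_transform_of_pos hx hm).trans (by ring))
    (hasDerivAt_sechSum (2 * m) hy) (hasDerivAt_oddCschSum (2 * m) hY)
  push_cast at h ⊢
  linear_combination -h

lemma oddCothCschSum_transform (hm : 1 ≤ m) :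
    oddCothCschSum (2 * m + 1) y =
      (-1) ^ (m + 1) * 2 ^ (2 * m + 1) * (π / y) ^ (2 * m + 1) *
        ((2 * m + 1) / y * sechSum (2 * m) (π ^ 2 / y) -
          π ^ 2 / y ^ 2 * tanhSechSum (2 * m + 1) (π ^ 2 / y)) := by
  have hY : 0 < π ^ 2 / y := by positivity
  have h := deriv_transform hy (fun x hx => oddCschSum_transform hx hm)
    (hasDerivAt_oddCschSum (2 * m) hy) (hasDerivAt_sechSum (2 * m) hY)
  push_cast at h ⊢
  linear_combination -2 * h

end Derivative

/-! ### Splitting the summands by `cosh² - sinh² = 1` -/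

lemma div_cosh_mul_sinh_sq {u : ℝ} (hu : u ≠ 0) (c : ℝ) :
    c / (cosh u * sinh u ^ 2) = c * cosh u / sinh u ^ 2 - c / cosh u := by
  have h1 := (cosh_pos u).ne'
  have h2 : sinh u ≠ 0 := by simpa using hu
  field_simp
  linear_combination -c * cosh_sq_sub_sinh_sq u

lemma div_sinh_mul_cosh_sq {u : ℝ} (hu : u ≠ 0) (c : ℝ) :
    c / (sinh u * cosh u ^ 2) = c / sinh u - c * sinh u / cosh u ^ 2 := by
  have h1 := (cosh_pos u).ne'
  have h2 : sinh u ≠ 0 := by simpa using hu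
  field_simp
  linear_combination -c * cosh_sq_sub_sinh_sq u

lemma two_mul_pnat_sub_one_ne_zero (n : ℕ+) : (2 * n - 1 : ℝ) ≠ 0 := by
  have hn : (1 : ℝ) ≤ n := by exact_mod_cast (one_le : 1 ≤ n)
  linarith

section Quotients

variable (k : ℕ) {y : ℝ} (hy : y ≠ 0)
include hy

lemma hasSum_sech_mul_csch_sq :
    HasSum (fun n : ℕ+ => (-1 : ℝ) ^ (n : ℕ) * (n : ℝ) ^ k / (cosh (n * y) * sinh (n * y) ^ 2))
      (cothCschSum k y - sechSum k y) :=
  ((summable_cothCsch k hy).hasSum.sub (summable_sech k hy).hasSum).congr_fun fun n =>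
    div_cosh_mul_sinh_sq (mul_ne_zero (by simp) hy) _

lemma hasSum_csch_mul_sech_sq :
    HasSum (fun n : ℕ+ => (-1 : ℝ) ^ (n : ℕ) * (n : ℝ) ^ k / (sinh (n * y) * cosh (n * y) ^ 2))
      (cschSum k y - tanhSechSum k y) :=
  ((summable_csch k hy).hasSum.sub (summable_tanhSech k hy).hasSum).congr_fun fun n =>
    div_sinh_mul_cosh_sq (mul_ne_zero (by simp) hy) _

lemma hasSum_odd_csch_sq_mul_sech :
    HasSum (fun n : ℕ+ => (-1 : ℝ) ^ (n : ℕ) * (2 * (n : ℝ) - 1) ^ k /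
        (sinh ((2 * n - 1) * y / 2) ^ 2 * cosh ((2 * n - 1) * y / 2)))
      (oddCothCschSum k y - oddSechSum k y) :=
  ((summable_oddCothCsch k hy).hasSum.sub (summable_oddSech k hy).hasSum).congr_fun fun n => by
    rw [mul_comm (sinh _ ^ 2)]
    exact div_cosh_mul_sinh_sq
      (div_ne_zero (mul_ne_zero (two_mul_pnat_sub_one_ne_zero n) hy) two_ne_zero) _

end Quotients

/-! ### The three formulas, for positive and then nonzero `y` -/

section Formulas

variable {m : ℕ} (hm : 1 ≤ m) {y : ℝ}
include hm

lemma sech_mul_csch_sq_formula_of_pos (hy : 0 < y) :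
    cothCschSum (2 * m) y - sechSum (2 * m) y =
      -(π ^ (2 * m) / y ^ (2 * m + 1)) * (2 * m) * (-1) ^ (m - 1) *
          cschSum (2 * m - 1) (π ^ 2 / y)
        - wConst (2 * m + 1) / (2 * y ^ 2)
        + π ^ (2 * m + 1) / (2 ^ (2 * m) * y ^ (2 * m + 1)) * (-1) ^ m *
          oddCschSum (2 * m) (π ^ 2 / y)
        - π ^ (2 * m + 2) / y ^ (2 * m + 2) * (-1) ^ m * cothCschSum (2 * m) (π ^ 2 / y) := by
  rw [cothCschSum_transform hy hm, sechSum_transform_of_pos hy hm]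
  obtain ⟨j, rfl⟩ : ∃ j, m = j + 1 := ⟨m - 1, by omega⟩
  rw [Nat.add_sub_cancel]
  push_cast
  ring

lemma csch_mul_sech_sq_formula_of_pos (hy : 0 < y) :
    cschSum (2 * m + 1) y - tanhSechSum (2 * m + 1) y =
      -(π ^ (2 * m + 2) / y ^ (2 * m + 2)) * (-1) ^ m * cschSum (2 * m + 1) (π ^ 2 / y)
        + (2 * m + 1) * π ^ (2 * m + 1) / (2 ^ (2 * m) * y ^ (2 * m + 2)) * (-1) ^ m *
          oddCschSum (2 * m) (π ^ 2 / y)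
        - π ^ (2 * m + 3) / (2 ^ (2 * m + 1) * y ^ (2 * m + 3)) * (-1) ^ m *
          oddCothCschSum (2 * m + 1) (π ^ 2 / y) := by
  rw [tanhSechSum_transform hy hm, cschSum_transform_of_pos hy hm]
  ring

lemma odd_csch_sq_mul_sech_formula_of_pos (hy : 0 < y) :
    oddCothCschSum (2 * m + 1) y - oddSechSum (2 * m + 1) y =
      -(π ^ (2 * m + 2) / y ^ (2 * m + 2)) * (-1) ^ m * oddSechSum (2 * m + 1) (π ^ 2 / y)
        - (2 * m + 1) * 2 ^ (2 * m + 1) * π ^ (2 * m + 1) / y ^ (2 * m + 2) * (-1) ^ m *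
          sechSum (2 * m) (π ^ 2 / y)
        + 2 ^ (2 * m + 1) * π ^ (2 * m + 3) / y ^ (2 * m + 3) * (-1) ^ m *
          tanhSechSum (2 * m + 1) (π ^ 2 / y) := by
  rw [oddCothCschSum_transform hy hm, oddSechSum_transform hy hm]
  ring

lemma sech_mul_csch_sq_formula (hy : y ≠ 0) :
    cothCschSum (2 * m) y - sechSum (2 * m) y =
      -(π ^ (2 * m) / y ^ (2 * m + 1)) * (2 * m) * (-1) ^ (m - 1) *
          cschSum (2 * m - 1) (π ^ 2 / y)
        - wConst (2 * m + 1) / (2 * y ^ 2)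
        + π ^ (2 * m + 1) / (2 ^ (2 * m) * y ^ (2 * m + 1)) * (-1) ^ m *
          oddCschSum (2 * m) (π ^ 2 / y)
        - π ^ (2 * m + 2) / y ^ (2 * m + 2) * (-1) ^ m * cothCschSum (2 * m) (π ^ 2 / y) := by
  rcases hy.lt_or_gt with h | h
  -- Both sides are even in `y`.
  · have := sech_mul_csch_sq_formula_of_pos hm (neg_pos.2 h)
    rw [div_neg, cothCschSum_neg, cothCschSum_neg, sechSum_neg, cschSum_neg, oddCschSum_neg,
      (odd_two_mul_add_one m).neg_pow,
      (show Even (2 * m + 2) from even_two_mul (m + 1)).neg_pow,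
      even_two.neg_pow] at this
    rw [this]
    ring
  · exact sech_mul_csch_sq_formula_of_pos hm h

lemma csch_mul_sech_sq_formula (hy : y ≠ 0) :
    cschSum (2 * m + 1) y - tanhSechSum (2 * m + 1) y =
      -(π ^ (2 * m + 2) / y ^ (2 * m + 2)) * (-1) ^ m * cschSum (2 * m + 1) (π ^ 2 / y)
        + (2 * m + 1) * π ^ (2 * m + 1) / (2 ^ (2 * m) * y ^ (2 * m + 2)) * (-1) ^ m *
          oddCschSum (2 * m) (π ^ 2 / y)
        - π ^ (2 * m + 3) / (2 ^ (2 * m + 1) * y ^ (2 * m + 3)) * (-1) ^ m *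
          oddCothCschSum (2 * m + 1) (π ^ 2 / y) := by
  rcases hy.lt_or_gt with h | h
  -- Both sides are odd in `y`.
  · have := csch_mul_sech_sq_formula_of_pos hm (neg_pos.2 h)
    rw [div_neg, cschSum_neg, cschSum_neg, tanhSechSum_neg, oddCschSum_neg, oddCothCschSum_neg,
      (show Odd (2 * m + 3) from odd_two_mul_add_one (m + 1)).neg_pow,
      (show Even (2 * m + 2) from even_two_mul (m + 1)).neg_pow] at this
    rw [← neg_inj, neg_sub, ← neg_sub_neg, this]
    ring
  · exact csch_mul_sech_sq_formula_of_pos hm h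

lemma odd_csch_sq_mul_sech_formula (hy : y ≠ 0) :
    oddCothCschSum (2 * m + 1) y - oddSechSum (2 * m + 1) y =
      -(π ^ (2 * m + 2) / y ^ (2 * m + 2)) * (-1) ^ m * oddSechSum (2 * m + 1) (π ^ 2 / y)
        - (2 * m + 1) * 2 ^ (2 * m + 1) * π ^ (2 * m + 1) / y ^ (2 * m + 2) * (-1) ^ m *
          sechSum (2 * m) (π ^ 2 / y)
        + 2 ^ (2 * m + 1) * π ^ (2 * m + 3) / y ^ (2 * m + 3) * (-1) ^ m *
          tanhSechSum (2 * m + 1) (π ^ 2 / y) := by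
  rcases hy.lt_or_gt with h | h
  · have := odd_csch_sq_mul_sech_formula_of_pos hm (neg_pos.2 h)
    rw [div_neg, oddCothCschSum_neg, oddSechSum_neg, oddSechSum_neg, sechSum_neg, tanhSechSum_neg,
      (show Odd (2 * m + 3) from odd_two_mul_add_one (m + 1)).neg_pow,
      (show Even (2 * m + 2) from even_two_mul (m + 1)).neg_pow] at this
    rw [this]
    ring
  · exact odd_csch_sq_mul_sech_formula_of_pos hm h

end Formulas

theorem mainTheorem5 (p : ℕ) (hp : 1 < p) (hodd : Odd p) (y : ℝ) (hy : y ≠ 0) :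
    -- all series converge (absolutely)
    (Summable (fun n : ℕ+ => (-1 : ℝ) ^ (n : ℕ) * (n : ℝ) ^ (p - 1) /
        (cosh (n * y) * sinh (n * y) ^ 2)) ∧
      Summable (fun n : ℕ+ => (-1 : ℝ) ^ (n : ℕ) * (n : ℝ) ^ p /
        (sinh (n * y) * cosh (n * y) ^ 2)) ∧
      Summable (fun n : ℕ+ => (-1 : ℝ) ^ (n : ℕ) * (2 * (n : ℝ) - 1) ^ p /
        (sinh ((2 * n - 1) * y / 2) ^ 2 * cosh ((2 * n - 1) * y / 2))) ∧
      Summable (fun n : ℕ+ => (-1 : ℝ) ^ (n : ℕ) * (n : ℝ) ^ (p - 2) / sinh (π ^ 2 * n / y)) ∧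
      Summable (fun n : ℕ+ => (-1 : ℝ) ^ (n : ℕ) * (n : ℝ) ^ p / sinh (π ^ 2 * n / y)) ∧
      Summable (fun n : ℕ+ => (-1 : ℝ) ^ (n : ℕ) * (2 * (n : ℝ) - 1) ^ (p - 1) /
        sinh ((2 * n - 1) * π ^ 2 / (2 * y))) ∧
      Summable (fun n : ℕ+ => (-1 : ℝ) ^ (n : ℕ) * (n : ℝ) ^ (p - 1) * cosh (n * π ^ 2 / y) /
        sinh (n * π ^ 2 / y) ^ 2) ∧
      Summable (fun n : ℕ+ => (-1 : ℝ) ^ (n : ℕ) * (2 * (n : ℝ) - 1) ^ p *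
        cosh ((2 * n - 1) * π ^ 2 / (2 * y)) / sinh ((2 * n - 1) * π ^ 2 / (2 * y)) ^ 2) ∧
      Summable (fun n : ℕ+ => (-1 : ℝ) ^ (n : ℕ) * (2 * (n : ℝ) - 1) ^ p /
        cosh ((2 * n - 1) * π ^ 2 / (2 * y))) ∧
      Summable (fun n : ℕ+ => (-1 : ℝ) ^ (n : ℕ) * (n : ℝ) ^ (p - 1) / cosh (π ^ 2 * n / y)) ∧
      Summable (fun n : ℕ+ => (-1 : ℝ) ^ (n : ℕ) * (n : ℝ) ^ p * sinh (π ^ 2 * n / y) /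
        cosh (π ^ 2 * n / y) ^ 2)) ∧
    -- first formula
    (∑' n : ℕ+, (-1 : ℝ) ^ (n : ℕ) * (n : ℝ) ^ (p - 1) / (cosh (n * y) * sinh (n * y) ^ 2) =
      -(π ^ (p - 1) / y ^ p) * ((p : ℝ) - 1) * (-1) ^ ((p - 3) / 2) *
          (∑' n : ℕ+, (-1 : ℝ) ^ (n : ℕ) * (n : ℝ) ^ (p - 2) / sinh (π ^ 2 * n / y))
        - wConst p / (2 * y ^ 2)
        + π ^ p / (2 ^ (p - 1) * y ^ p) * (-1) ^ ((p - 1) / 2) *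
          (∑' n : ℕ+, (-1 : ℝ) ^ (n : ℕ) * (2 * (n : ℝ) - 1) ^ (p - 1) /
            sinh ((2 * n - 1) * π ^ 2 / (2 * y)))
        - π ^ (p + 1) / y ^ (p + 1) * (-1) ^ ((p - 1) / 2) *
          (∑' n : ℕ+, (-1 : ℝ) ^ (n : ℕ) * (n : ℝ) ^ (p - 1) * cosh (n * π ^ 2 / y) /
            sinh (n * π ^ 2 / y) ^ 2)) ∧
    -- second formula
    (∑' n : ℕ+, (-1 : ℝ) ^ (n : ℕ) * (n : ℝ) ^ p / (sinh (n * y) * cosh (n * y) ^ 2) =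
      -(π ^ (p + 1) / y ^ (p + 1)) * (-1) ^ ((p - 1) / 2) *
          (∑' n : ℕ+, (-1 : ℝ) ^ (n : ℕ) * (n : ℝ) ^ p / sinh (π ^ 2 * n / y))
        + p * π ^ p / (2 ^ (p - 1) * y ^ (p + 1)) * (-1) ^ ((p - 1) / 2) *
          (∑' n : ℕ+, (-1 : ℝ) ^ (n : ℕ) * (2 * (n : ℝ) - 1) ^ (p - 1) /
            sinh ((2 * n - 1) * π ^ 2 / (2 * y)))
        - π ^ (p + 2) / (2 ^ p * y ^ (p + 2)) * (-1) ^ ((p - 1) / 2) *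
          (∑' n : ℕ+, (-1 : ℝ) ^ (n : ℕ) * (2 * (n : ℝ) - 1) ^ p *
            cosh ((2 * n - 1) * π ^ 2 / (2 * y)) / sinh ((2 * n - 1) * π ^ 2 / (2 * y)) ^ 2)) ∧
    -- third formula
    (∑' n : ℕ+, (-1 : ℝ) ^ (n : ℕ) * (2 * (n : ℝ) - 1) ^ p /
        (sinh ((2 * n - 1) * y / 2) ^ 2 * cosh ((2 * n - 1) * y / 2)) =
      -(π ^ (p + 1) / y ^ (p + 1)) * (-1) ^ ((p - 1) / 2) *
          (∑' n : ℕ+, (-1 : ℝ) ^ (n : ℕ) * (2 * (n : ℝ) - 1) ^ p /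
            cosh ((2 * n - 1) * π ^ 2 / (2 * y)))
        - p * 2 ^ p * π ^ p / y ^ (p + 1) * (-1) ^ ((p - 1) / 2) *
          (∑' n : ℕ+, (-1 : ℝ) ^ (n : ℕ) * (n : ℝ) ^ (p - 1) / cosh (π ^ 2 * n / y))
        + 2 ^ p * π ^ (p + 2) / y ^ (p + 2) * (-1) ^ ((p - 1) / 2) *
          (∑' n : ℕ+, (-1 : ℝ) ^ (n : ℕ) * (n : ℝ) ^ p * sinh (π ^ 2 * n / y) /
            cosh (π ^ 2 * n / y) ^ 2)) := by
  -- Here `p = 2 m + 1` with `m ≥ 1`, so none of the natural subtractions in exponents truncates.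
  obtain ⟨m, rfl⟩ := hodd
  have hm : 1 ≤ m := by omega
  have hY : π ^ 2 / y ≠ 0 := div_ne_zero (pow_ne_zero 2 pi_ne_zero) hy
  have e1 : ∀ n : ℕ+, π ^ 2 * (n : ℝ) / y = n * (π ^ 2 / y) := fun n => by ring
  have e2 : ∀ n : ℕ+, (n : ℝ) * π ^ 2 / y = n * (π ^ 2 / y) := fun n => by ring
  have e3 : ∀ n : ℕ+, (2 * (n : ℝ) - 1) * π ^ 2 / (2 * y) = (2 * n - 1) * (π ^ 2 / y) / 2 :=
    fun n => by ring
  have e4 : 2 * m + 1 - 2 = 2 * m - 1 := by omega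
  have e5 : (2 * m + 1 - 3) / 2 = m - 1 := by omega
  have e6 : 2 * m / 2 = m := by omega
  simp only [e1, e2, e3, e4, e5, Nat.add_sub_cancel, e6]
  have s1 := hasSum_sech_mul_csch_sq (2 * m) hy
  have s2 := hasSum_csch_mul_sech_sq (2 * m + 1) hy
  have s3 := hasSum_odd_csch_sq_mul_sech (2 * m + 1) hy
  refine ⟨⟨s1.summable, s2.summable, s3.summable, summable_csch _ hY, summable_csch _ hY,
    summable_oddCsch _ hY, summable_cothCsch _ hY, summable_oddCothCsch _ hY, summable_oddSech _ hY,
    summable_sech _ hY, summable_tanhSech _ hY⟩, ?_, ?_, ?_⟩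
  · rw [s1.tsum_eq, sech_mul_csch_sq_formula hm hy]
    push_cast
    rw [add_sub_cancel_right]
    rfl
  · rw [s2.tsum_eq, csch_mul_sech_sq_formula hm hy]
    push_cast
    rfl
  · rw [s3.tsum_eq, odd_csch_sq_mul_sech_formula hm hy]
    push_cast
    rfl
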